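/- **Conventions.** A *monoid of covers* (pre-uniformity) on a set $X$ is a set $\mu$ of coverings of $X$ by subsets of $X$ that contains $\{X\}$, is closed under meets $\mathcal U\wedge\mathcal V=\{U\cap V: U\in\mathcal U, V\in\mathcal V\}$, and contains every cover refined by one of its members ($\mathcal U$ refines $\mathcal V$ if each $U\in\mathcal U$ lies in some $V\in\mathcal V$). It is *locally fine* if $\{U\cap V: U\in\mathcal U, V\in\mathcal V_U\}\in\mu$ whenever $\mathcal U\in\mu$ and $\mathcal V_U\in\mu$ for each $U\in\mathcal U$. The *locally fine coreflection* $\lambda\mu$ is the least locally fine monoid of covers containing $\mu$. If $\mu_i$ is a monoid of covers on $X_i$ for each $i\in I$, the product $\Pi\mu_i$ on $\Pi X_i$ consists of all covers refined by a finite meet of pullbacks $\pi_i^{-1}[\mathcal U_i]$, $\mathcal U_i\in\mu_i$. For a topological space $X$, $\mathcal O(X)^*$ is the monoid of all covers of $X$ that are refined by an open cover of $X$. $T(X)$ is the frame of open subsets of $X$, regarded as a locale, and $\Pi_{\mathrm{loc}}$ is the product in the category of locales (the coproduct in the category of frames). A locale $L$ is *spatial* if for all $x\neq y$ in $L$ there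 is a frame homomorphism $\phi:L\to\{0,1\}$ with $\phi(x)\neq\phi(y)$. **Theorem 8.6.** Let $(X_i)_{i\in I}$ be any family of regular topological spaces. Then the localic product $\Pi_{\mathrm{loc}}T(X_i)$ is spatial if and only if $$\lambda\bigl(\Pi\,\mathcal O(X_i)^*\bigr)=\mathcal O\bigl(\Pi X_i\bigr)^*,$$ where $\Pi X_i$ on the right carries the product topology. -/

import Mathlib

universe u v

/-! ### Covering relations and the locales they generate -/

section CoveringRelations

/-- `meetSet U V` is the set `U ∧ V` of all elements bounded by both `U` and `V`. -/
def meetSet {P : Type u} [Preorder P] (U V : Set P) : Set P :=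
  {p | (∃ x ∈ U, p ≤ x) ∧ ∃ y ∈ V, p ≤ y}

/-- A covering relation on a pre-ordered set. -/
structure CoveringRelation (P : Type u) [Preorder P] where
  /-- `Cov a U`: the element `a` is covered by the set `U`. -/
  Cov : P → Set P → Prop
  refl : ∀ {a : P} {U : Set P}, a ∈ U → Cov a U
  le : ∀ {a b : P}, a ≤ b → Cov a {b}
  meet : ∀ {a : P} {U V : Set P}, Cov a U → Cov a V → Cov a (meetSet U V)
  trans : ∀ {a : P} {U V : Set P}, Cov a U → (∀ x ∈ U, Cov x V) → Cov a V

/-- Closure of a set `G` of generators under the four conditions of covering relations. -/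
inductive GeneratedCov {P : Type u} [Preorder P] (G : P → Set P → Prop) : P → Set P → Prop
  | gen {a : P} {U : Set P} : G a U → GeneratedCov G a U
  | refl {a : P} {U : Set P} : a ∈ U → GeneratedCov G a U
  | le {a b : P} : a ≤ b → GeneratedCov G a {b}
  | meet {a : P} {U V : Set P} :
      GeneratedCov G a U → GeneratedCov G a V → GeneratedCov G a (meetSet U V)
  | trans {a : P} {U V : Set P} :
      GeneratedCov G a U → (∀ x ∈ U, GeneratedCov G x V) → GeneratedCov G a V

/-- The covering relation generated by `G`. -/
def CoveringRelation.generate {P : Type u} [Preorder P] (G : P → Set P → Prop) :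
    CoveringRelation P where
  Cov := GeneratedCov G
  refl := GeneratedCov.refl
  le := GeneratedCov.le
  meet := GeneratedCov.meet
  trans := GeneratedCov.trans

namespace CoveringRelation

variable {P : Type u} [Preorder P] (C : CoveringRelation P)

theorem mono {a : P} {U V : Set P} (h : C.Cov a U) (hUV : U ⊆ V) : C.Cov a V :=
  C.trans h fun _ hx => C.refl (hUV hx)

theorem of_le {a b : P} {U : Set P} (hab : a ≤ b) (h : C.Cov b U) : C.Cov a U :=
  C.trans (C.le hab) fun x hx => by rw [Set.mem_singleton_iff.1 hx]; exact h

/-- `U ~ V` if every element of `U` is covered by `V` and every element of `V` by `U`. -/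
def setoid : Setoid (Set P) where
  r U V := (∀ x ∈ U, C.Cov x V) ∧ ∀ y ∈ V, C.Cov y U
  iseqv :=
    { refl := fun _ => ⟨fun _ hx => C.refl hx, fun _ hx => C.refl hx⟩
      symm := fun h => ⟨h.2, h.1⟩
      trans := fun h k => ⟨fun x hx => C.trans (h.1 x hx) k.1,
        fun x hx => C.trans (k.2 x hx) h.2⟩ }

/-- The locale (frame) generated by a covering relation: the classes `[U]` of subsets `U` of `P`,
with `[U] ≤ [V]` if every element of `U` is covered by `V`. -/
def Loc : Type u := Quotient C.setoid

namespace Loc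

variable {C}

/-- The class `[U]`. -/
def mk (U : Set P) : C.Loc := Quotient.mk C.setoid U

theorem exists_rep (x : C.Loc) : ∃ U : Set P, mk U = x := Quotient.exists_rep x

instance : PartialOrder C.Loc where
  le := Quotient.lift₂ (fun U V => ∀ x ∈ U, C.Cov x V) (by
    intro U V U' V' hU hV
    refine propext ⟨fun h x hx => ?_, fun h x hx => ?_⟩
    · exact C.trans (C.trans (hU.2 x hx) h) hV.1
    · exact C.trans (C.trans (hU.1 x hx) h) hV.2)
  le_refl := by
    rintro ⟨U⟩
    exact fun x hx => C.refl hx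
  le_trans := by
    rintro ⟨U⟩ ⟨V⟩ ⟨W⟩ h k
    exact fun x hx => C.trans (h x hx) k
  le_antisymm := by
    rintro ⟨U⟩ ⟨V⟩ h k
    exact Quotient.sound ⟨h, k⟩

theorem mk_le_mk {U V : Set P} : (mk U : C.Loc) ≤ mk V ↔ ∀ x ∈ U, C.Cov x V := Iff.rfl

/-- `[U] ∧ [V] = [U ∧ V]`. -/
def meet : C.Loc → C.Loc → C.Loc :=
  Quotient.lift₂ (fun U V => (mk (meetSet U V) : C.Loc)) (by
    intro U V U' V' hU hV
    refine le_antisymm (mk_le_mk.2 ?_) (mk_le_mk.2 ?_)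
    · rintro x ⟨⟨a, ha, hxa⟩, b, hb, hxb⟩
      exact C.meet (C.of_le hxa (hU.1 a ha)) (C.of_le hxb (hV.1 b hb))
    · rintro x ⟨⟨a, ha, hxa⟩, b, hb, hxb⟩
      exact C.meet (C.of_le hxa (hU.2 a ha)) (C.of_le hxb (hV.2 b hb)))

/-- The join of a family of classes is the class of the union of representatives. -/
def join (S : Set C.Loc) : C.Loc := mk {p | ∃ U : Set P, mk U ∈ S ∧ p ∈ U}

theorem isLUB_join (S : Set C.Loc) : IsLUB S (join S) := by
  refine ⟨fun y hy => ?_, fun y hy => ?_⟩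
  · obtain ⟨U, rfl⟩ := exists_rep y
    exact mk_le_mk.2 fun x hx => C.refl ⟨U, hy, hx⟩
  · obtain ⟨V, rfl⟩ := exists_rep y
    refine mk_le_mk.2 ?_
    rintro x ⟨U, hU, hx⟩
    exact mk_le_mk.1 (hy hU) x hx

instance : CompleteLattice C.Loc where
  __ := @completeLatticeOfSup C.Loc _ ⟨join⟩ isLUB_join
  inf := meet
  inf_le_left := by
    rintro ⟨U⟩ ⟨V⟩
    rintro x ⟨⟨a, ha, hxa⟩, -⟩
    exact C.of_le hxa (C.refl ha)
  inf_le_right := by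
    rintro ⟨U⟩ ⟨V⟩
    rintro x ⟨-, b, hb, hxb⟩
    exact C.of_le hxb (C.refl hb)
  le_inf := by
    rintro ⟨U⟩ ⟨V⟩ ⟨W⟩ h k
    exact fun x hx => C.meet (h x hx) (k x hx)

instance : Order.Frame C.Loc :=
  Order.Frame.ofMinimalAxioms
    { inf_sSup_le_iSup_inf := by
        intro a S
        suffices h : ∀ y : C.Loc, (∀ b ∈ S, a ⊓ b ≤ y) → a ⊓ sSup S ≤ y from
          h _ fun b hb => le_iSup₂_of_le b hb le_rfl
        intro y hy
        obtain ⟨U, rfl⟩ := exists_rep a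
        obtain ⟨W, rfl⟩ := exists_rep y
        refine mk_le_mk.2 ?_
        rintro x ⟨⟨p, hp, hxp⟩, q, ⟨V, hV, hq⟩, hxq⟩
        exact mk_le_mk.1 (hy (mk V) hV) x ⟨⟨p, hp, hxp⟩, q, hq, hxq⟩ }

theorem mk_inf_mk (U V : Set P) : (mk U : C.Loc) ⊓ mk V = mk (meetSet U V) := rfl

theorem sSup_eq (S : Set C.Loc) : sSup S = mk {p | ∃ U : Set P, mk U ∈ S ∧ p ∈ U} := rfl

end Loc

end CoveringRelation

end CoveringRelations

/-! ### The localic product, and spatial locales -/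

section LocalicProducts

variable {ι : Type u} (L : ι → Type v) [∀ i, Order.Frame (L i)]

/-- The weak direct product: families `(aᵢ)` with `aᵢ = 1` for all but finitely many `i`,
ordered coordinatewise. -/
def WeakProduct : Type (max u v) := {a : ∀ i, L i // {i | a i ≠ ⊤}.Finite}

instance : PartialOrder (WeakProduct L) :=
  inferInstanceAs (PartialOrder {a : ∀ i, L i // {i | a i ≠ ⊤}.Finite})

/-- The generators `(a, U)`: the set `U` arises from `a` by splitting the `i`-th coordinate along
a set `S` in `L i` with `aᵢ ≤ ⋁ S`. (For `S = ∅` this says that a family having a coordinate `0`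
is covered by the empty set.) -/
def SplitCov (a : WeakProduct L) (U : Set (WeakProduct L)) : Prop :=
  ∃ (i : ι) (S : Set (L i)), a.1 i ≤ sSup S ∧
    U = {b | b.1 i ∈ S ∧ ∀ j, j ≠ i → b.1 j = a.1 j}

/-- The product of the `L i` in the category of locales, that is, their coproduct in the category
of frames. -/
abbrev LocalicProduct : Type (max u v) := (CoveringRelation.generate (SplitCov L)).Loc

end LocalicProducts

/-- A locale is spatial if its points, the frame homomorphisms to the two-element frame,
distinguish its elements. -/
def IsSpatial (L : Type u) [Order.Frame L] : Prop :=
  ∀ x y : L, x ≠ y → ∃ p : FrameHom L Prop, p x ≠ p y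

/-! ### Monoids of covers (pre-uniformities) and the locally fine coreflection -/

section CoverMonoids

/-- `U` refines `V`. -/
def Refines {X : Type u} (U V : Set (Set X)) : Prop := ∀ s ∈ U, ∃ t ∈ V, s ⊆ t

/-- The family of all sets `s ∩ t` with `s ∈ U` and `t ∈ V s`. -/
def localize {X : Type u} (U : Set (Set X)) (V : Set X → Set (Set X)) : Set (Set X) :=
  {r | ∃ s ∈ U, ∃ t ∈ V s, r = s ∩ t}

/-- A monoid of covers (a pre-uniformity) on a set `X`: a filter of coverings of `X`. -/
@[ext]
structure CoverMonoid (X : Type u) where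
  covers : Set (Set (Set X))
  sUnion_eq : ∀ U ∈ covers, ⋃₀ U = Set.univ
  univ_mem : {Set.univ} ∈ covers
  upward : ∀ U ∈ covers, ∀ V, Refines U V → V ∈ covers
  meet_mem : ∀ U ∈ covers, ∀ V ∈ covers, {r | ∃ s ∈ U, ∃ t ∈ V, r = s ∩ t} ∈ covers

theorem Refines.sUnion_eq {X : Type u} {U V : Set (Set X)} (h : Refines U V)
    (hU : ⋃₀ U = Set.univ) : ⋃₀ V = Set.univ := by
  refine Set.eq_univ_of_forall fun x => ?_
  obtain ⟨s, hs, hx⟩ := Set.mem_sUnion.1 (hU ▸ Set.mem_univ x)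
  obtain ⟨t, ht, hst⟩ := h s hs
  exact ⟨t, ht, hst hx⟩

theorem Refines.trans {X : Type u} {U V W : Set (Set X)} (h : Refines U V) (k : Refines V W) :
    Refines U W := fun s hs => by
  obtain ⟨t, ht, hst⟩ := h s hs
  obtain ⟨r, hr, htr⟩ := k t ht
  exact ⟨r, hr, hst.trans htr⟩

theorem Refines.rfl {X : Type u} {U : Set (Set X)} : Refines U U := fun s hs => ⟨s, hs, le_rfl⟩

namespace CoverMonoid

/-- The fine monoid of covers of a topological space: all covers which have an open
refinement (an open cover refining them). -/
def fine (X : Type u) [TopologicalSpace X] : CoverMonoid X where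
  covers := {U | ∃ V : Set (Set X), (∀ s ∈ V, IsOpen s) ∧ ⋃₀ V = Set.univ ∧ Refines V U}
  sUnion_eq := fun _ ⟨_, _, h, k⟩ => k.sUnion_eq h
  univ_mem := ⟨{Set.univ}, by simp, by simp, Refines.rfl⟩
  upward := fun _ ⟨V, h, k, l⟩ _ hW => ⟨V, h, k, l.trans hW⟩
  meet_mem := by
    rintro U ⟨U', hU', cU, rU⟩ V ⟨V', hV', cV, rV⟩
    refine ⟨{r | ∃ s ∈ U', ∃ t ∈ V', r = s ∩ t}, ?_, ?_, ?_⟩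
    · rintro _ ⟨s, hs, t, ht, rfl⟩
      exact (hU' s hs).inter (hV' t ht)
    · refine Set.eq_univ_of_forall fun x => ?_
      obtain ⟨s, hs, hxs⟩ := Set.mem_sUnion.1 (cU ▸ Set.mem_univ x)
      obtain ⟨t, ht, hxt⟩ := Set.mem_sUnion.1 (cV ▸ Set.mem_univ x)
      exact ⟨s ∩ t, ⟨s, hs, t, ht, rfl⟩, hxs, hxt⟩
    · rintro _ ⟨s, hs, t, ht, rfl⟩
      obtain ⟨s', hs', h1⟩ := rU s hs
      obtain ⟨t', ht', h2⟩ := rV t ht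
      exact ⟨s' ∩ t', ⟨s', hs', t', ht', rfl⟩, Set.inter_subset_inter h1 h2⟩

/-- The basic rectangular cover of a product: the meet of the pullbacks `πᵢ⁻¹[U i]`, `i ∈ E`. -/
def rectangles {ι : Type u} {X : ι → Type v} (E : Finset ι) (U : ∀ i, Set (Set (X i))) :
    Set (Set (∀ i, X i)) :=
  {r | ∃ s : ∀ i, Set (X i), (∀ i ∈ E, s i ∈ U i) ∧ r = {x | ∀ i ∈ E, x i ∈ s i}}

/-- The product of monoids of covers: the covers refined by a basic rectangular cover, that is, by
a finite meet of pullbacks of covers of the factors. -/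
def prod {ι : Type u} {X : ι → Type v} (μ : ∀ i, CoverMonoid (X i)) :
    CoverMonoid (∀ i, X i) where
  covers := {W | ∃ (E : Finset ι) (U : ∀ i, Set (Set (X i))),
    (∀ i, U i ∈ (μ i).covers) ∧ Refines (rectangles E U) W}
  sUnion_eq := by
    rintro W ⟨E, U, hU, hW⟩
    refine hW.sUnion_eq (Set.eq_univ_of_forall fun x => ?_)
    have h : ∀ i, ∃ s ∈ U i, x i ∈ s := fun i =>
      Set.mem_sUnion.1 ((μ i).sUnion_eq _ (hU i) ▸ Set.mem_univ (x i))
    choose s hs hx using h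
    exact ⟨_, ⟨s, fun i _ => hs i, rfl⟩, fun i _ => hx i⟩
  univ_mem := ⟨∅, fun _ => {Set.univ}, fun i => (μ i).univ_mem,
    fun _ _ => ⟨Set.univ, rfl, Set.subset_univ _⟩⟩
  upward := fun _ ⟨E, U, hU, h⟩ _ hV => ⟨E, U, hU, h.trans hV⟩
  meet_mem := by
    classical
    rintro W ⟨E, U, hU, hW⟩ W' ⟨E', U', hU', hW'⟩
    refine ⟨E ∪ E', fun i => {r | ∃ s ∈ U i, ∃ t ∈ U' i, r = s ∩ t},
      fun i => (μ i).meet_mem _ (hU i) _ (hU' i), ?_⟩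
    rintro _ ⟨r, hr, rfl⟩
    have h : ∀ i, ∃ s t : Set (X i), i ∈ E ∪ E' → s ∈ U i ∧ t ∈ U' i ∧ r i = s ∩ t := by
      intro i
      by_cases hi : i ∈ E ∪ E'
      · obtain ⟨s, hs, t, ht, e⟩ := hr i hi
        exact ⟨s, t, fun _ => ⟨hs, ht, e⟩⟩
      · exact ⟨∅, ∅, fun h => absurd h hi⟩
    choose s t hst using h
    obtain ⟨w, hw, h1⟩ := hW _
      ⟨s, fun i hi => (hst i (Finset.mem_union_left _ hi)).1, rfl⟩
    obtain ⟨w', hw', h2⟩ := hW' _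
      ⟨t, fun i hi => (hst i (Finset.mem_union_right _ hi)).2.1, rfl⟩
    refine ⟨w ∩ w', ⟨w, hw, w', hw', rfl⟩, fun x hx => ⟨h1 fun i hi => ?_, h2 fun i hi => ?_⟩⟩
    · have h3 := hx i (Finset.mem_union_left _ hi)
      rw [(hst i (Finset.mem_union_left _ hi)).2.2] at h3
      exact h3.1
    · have h3 := hx i (Finset.mem_union_right _ hi)
      rw [(hst i (Finset.mem_union_right _ hi)).2.2] at h3
      exact h3.2

/-- A monoid of covers is locally fine if it contains every cover `{Uᵢ ∩ Vⁱⱼ}`, where `{Uᵢ}` and,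
for each `i`, `{Vⁱⱼ}` belong to it. -/
def LocallyFine {X : Type u} (μ : CoverMonoid X) : Prop :=
  ∀ U ∈ μ.covers, ∀ V : Set X → Set (Set X), (∀ s ∈ U, V s ∈ μ.covers) →
    localize U V ∈ μ.covers

/-- The covers obtained from those of `μ` by iterated localization: besides the covers in `μ`, all
families refined by a family `{Uᵢ ∩ Vⁱⱼ}`, where `{Uᵢ}` is in `μ` and each `{Vⁱⱼ}` has already
been obtained. -/
inductive LamCover {X : Type u} (μ : CoverMonoid X) : Set (Set X) → Prop
  | base {U : Set (Set X)} : U ∈ μ.covers → LamCover μ U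
  | step {U W : Set (Set X)} (V : Set X → Set (Set X)) : U ∈ μ.covers →
      (∀ s ∈ U, LamCover μ (V s)) → Refines (localize U V) W → LamCover μ W

theorem LamCover.upward {X : Type u} {μ : CoverMonoid X} {U W : Set (Set X)}
    (h : LamCover μ U) (hW : Refines U W) : LamCover μ W := by
  cases h with
  | base h => exact .base (μ.upward _ h _ hW)
  | step V h k l => exact .step V h k (l.trans hW)

theorem LamCover.localize {X : Type u} {μ : CoverMonoid X} {U : Set (Set X)}
    (h : LamCover μ U) :
    ∀ V : Set X → Set (Set X), (∀ s ∈ U, LamCover μ (V s)) → LamCover μ (localize U V) := by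
  induction h with
  | base h => exact fun V hV => .step V h hV Refines.rfl
  | @step U W V hU _ hW ih =>
    intro Z hZ
    have hf : ∀ s t, ∃ w, s ∈ U → t ∈ V s → w ∈ W ∧ s ∩ t ⊆ w := by
      intro s t
      by_cases h : s ∈ U ∧ t ∈ V s
      · obtain ⟨w, hw, hsub⟩ := hW _ ⟨s, h.1, t, h.2, rfl⟩
        exact ⟨w, fun _ _ => ⟨hw, hsub⟩⟩
      · exact ⟨∅, fun h1 h2 => absurd ⟨h1, h2⟩ h⟩
    choose f hf using hf
    refine .step (fun s => _root_.localize (V s) fun t => Z (f s t)) hU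
      (fun s hs => ih s hs _ fun t ht => hZ _ (hf s t hs ht).1) ?_
    rintro _ ⟨s, hs, _, ⟨t, ht, z, hz, rfl⟩, rfl⟩
    refine ⟨f s t ∩ z, ⟨_, (hf s t hs ht).1, z, hz, rfl⟩, ?_⟩
    exact fun x hx => ⟨(hf s t hs ht).2 ⟨hx.1, hx.2.1⟩, hx.2.2⟩

/-- The locally fine coreflection `λμ` of a monoid of covers `μ`. -/
def lam {X : Type u} (μ : CoverMonoid X) : CoverMonoid X where
  covers := {U | LamCover μ U}
  sUnion_eq := by
    intro U hU
    induction hU with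
    | base h => exact μ.sUnion_eq _ h
    | @step U W V hU _ hW ih =>
      refine hW.sUnion_eq (Set.eq_univ_of_forall fun x => ?_)
      obtain ⟨s, hs, hxs⟩ := Set.mem_sUnion.1 (μ.sUnion_eq _ hU ▸ Set.mem_univ x)
      obtain ⟨t, ht, hxt⟩ := Set.mem_sUnion.1 (ih s hs ▸ Set.mem_univ x)
      exact ⟨s ∩ t, ⟨s, hs, t, ht, rfl⟩, hxs, hxt⟩
  univ_mem := .base μ.univ_mem
  upward := fun _ hU _ hV => hU.upward hV
  meet_mem := fun _ hU V hV => hU.localize (fun _ => V) fun _ _ => hV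

theorem lam_locallyFine {X : Type u} (μ : CoverMonoid X) : μ.lam.LocallyFine :=
  fun _ hU V hV => LamCover.localize hU V hV

/-- `λμ` is the least locally fine monoid of covers containing `μ`. -/
theorem lam_isLeast {X : Type u} (μ : CoverMonoid X) :
    IsLeast {c | ∃ ν : CoverMonoid X, ν.LocallyFine ∧ μ.covers ⊆ ν.covers ∧ c = ν.covers}
      μ.lam.covers := by
  refine ⟨⟨μ.lam, μ.lam_locallyFine, fun _ hU => .base hU, rfl⟩, ?_⟩
  rintro _ ⟨ν, hν, hμ, rfl⟩ U hU
  induction hU with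
  | base h => exact hμ h
  | step V hU _ hW ih => exact ν.upward _ (hν _ (hμ hU) V ih) _ hW

end CoverMonoid

end CoverMonoids

open Set TopologicalSpace

/-! ### The weak direct product as a meet-semilattice -/

section WeakProducts

variable {ι : Type u} {L : ι → Type v} [∀ i, Order.Frame (L i)]

namespace WeakProduct

/-! Both sides of the equivalence are inductive ways of building covers, and the proof translates
one into the other. The localic product is presented by open boxes, with covers generated by
splitting one coordinate at a time. Such a cover always covers the box pointwise
(`subset_biUnion_box_of_cov`). Regularity makes every point of the locale come from a point of the
product space, so spatiality becomes the converse: every pointwise cover of a box by boxes is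
derivable from splittings (`isSpatial_localicProduct_iff`). On the other side, the coreflection
always lies inside the fine monoid, so equality says that every open cover is reached from
rectangular covers by iterated localization.

Localized covers turn into splittings directly (`LamCover.cov`). The opposite translation meets an
obstacle: a splitting covers one box, while a monoid of covers consists of covers of the whole
product. Regularity removes it (`coversOn_of_cov`). If the closure of `b i` lies in `a i`, then
adjoining the complement of that closure to a splitting of `a i` gives an open cover of the whole
factor, and the adjoined piece misses the box of `b`. The same device, together with
`cov_closure_subset`, turns a pointwise cover of a box into open covers of the product. -/

instance : OrderTop (WeakProduct L) where
  top := ⟨fun _ => ⊤, by simp⟩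
  le_top _ _ := le_top

instance : SemilatticeInf (WeakProduct L) where
  inf a b := ⟨fun i => a.1 i ⊓ b.1 i, (a.2.union b.2).subset fun i hi => by
    by_contra h
    simp only [mem_union, mem_ofPred_eq, not_or, not_not] at h
    exact hi ((congrArg₂ _ h.1 h.2).trans (inf_top_eq _))⟩
  inf_le_left _ _ _ := inf_le_left
  inf_le_right _ _ _ := inf_le_right
  le_inf _ _ _ h k i := le_inf (h i) (k i)

theorem apply_le {a b : WeakProduct L} (h : a ≤ b) (i : ι) : a.1 i ≤ b.1 i := h i

theorem inf_apply (a b : WeakProduct L) (i : ι) : (a ⊓ b).1 i = a.1 i ⊓ b.1 i := rfl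

open Classical in
/-- Replace the `i`-th coordinate of a family. -/
noncomputable def update (a : WeakProduct L) (i : ι) (o : L i) : WeakProduct L :=
  ⟨Function.update a.1 i o, (a.2.union (finite_singleton i)).subset fun j hj => by
    by_cases h : j = i
    · exact Or.inr h
    · left
      simpa [Function.update_of_ne h] using hj⟩

@[simp] theorem update_self (a : WeakProduct L) (i : ι) (o : L i) : (a.update i o).1 i = o := by
  simp [update]

theorem update_of_ne (a : WeakProduct L) {i j : ι} (h : j ≠ i) (o : L i) :
    (a.update i o).1 j = a.1 j := by
  simp [update, h]

end WeakProduct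

/-- The covering relation presenting the localic product. -/
abbrev productCov (L : ι → Type v) [∀ i, Order.Frame (L i)] :
    CoveringRelation (WeakProduct L) :=
  CoveringRelation.generate (SplitCov L)

theorem productCov_split (a : WeakProduct L) (i : ι) {S : Set (L i)} (h : a.1 i ≤ sSup S) :
    (productCov L).Cov a {b | b.1 i ∈ S ∧ ∀ j, j ≠ i → b.1 j = a.1 j} :=
  .gen ⟨i, S, h, rfl⟩

theorem productCov_empty {a : WeakProduct L} {i : ι} (h : a.1 i = ⊥) :
    (productCov L).Cov a ∅ := by
  simpa using productCov_split a i (S := ∅) (by simp [h])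

/-- Finitely many conditions that can be achieved separately on a cover can be achieved
together. -/
theorem CoveringRelation.cov_forall_mem {P : Type u} [Preorder P] (C : CoveringRelation P)
    {κ : Type v} (p : κ → P → Prop) (hp : ∀ k, ∀ b c, b ≤ c → p k c → p k b) {a : P}
    (E : Finset κ) (h : ∀ k ∈ E, C.Cov a {b | p k b}) : C.Cov a {b | ∀ k ∈ E, p k b} := by
  classical
  induction E using Finset.induction_on with
  | empty => exact C.refl (by simp)
  | insert k E _ ih =>
    refine C.mono (C.meet (h k (by simp)) (ih fun j hj => h j (by simp [hj]))) ?_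
    rintro b ⟨⟨x, hx, hbx⟩, y, hy, hby⟩ j hj
    rcases Finset.mem_insert.1 hj with rfl | hj
    · exact hp _ _ _ hbx hx
    · exact hp _ _ _ hby (hy j hj)

/-- A cover of `a` may be restricted to elements below `a`. -/
theorem CoveringRelation.cov_inter_Iic {P : Type u} [Preorder P] (C : CoveringRelation P)
    {a : P} {U : Set P} (hU : ∀ b c, b ≤ c → c ∈ U → b ∈ U) (h : C.Cov a U) :
    C.Cov a {b | b ≤ a ∧ b ∈ U} := by
  refine C.mono (C.meet (C.le le_rfl) h) ?_
  rintro b ⟨⟨x, hx, hbx⟩, y, hy, hby⟩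
  rw [mem_singleton_iff.1 hx] at hbx
  exact ⟨hbx, hU _ _ hby hy⟩

end WeakProducts

/-! ### Open boxes in a product of spaces -/

section Boxes

variable {ι : Type u} {X : ι → Type v} [∀ i, TopologicalSpace (X i)]

/-- The open box in the product space given by an element of the weak product. -/
def box (a : WeakProduct fun i => Opens (X i)) : Set (∀ i, X i) := {x | ∀ i, x i ∈ a.1 i}

theorem box_mono {a b : WeakProduct fun i => Opens (X i)} (h : a ≤ b) : box a ⊆ box b :=
  fun _ hx i => h i (hx i)

theorem box_top : box (⊤ : WeakProduct fun i => Opens (X i)) = univ :=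
  eq_univ_of_forall fun _ _ => trivial

theorem box_inf (a b : WeakProduct fun i => Opens (X i)) : box (a ⊓ b) = box a ∩ box b :=
  Subset.antisymm (subset_inter (box_mono inf_le_left) (box_mono inf_le_right))
    fun _ hx i => ⟨hx.1 i, hx.2 i⟩

theorem isOpen_box (a : WeakProduct fun i => Opens (X i)) : IsOpen (box a) := by
  have h : box a = {i | a.1 i ≠ ⊤}.pi fun i => (a.1 i : Set (X i)) := by
    refine Subset.antisymm (fun x hx i _ => hx i) fun x hx i => ?_
    by_cases hi : a.1 i = ⊤
    · rw [hi]; trivial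
    · exact hx i hi
  rw [h]
  exact isOpen_set_pi a.2 fun i _ => (a.1 i).isOpen

theorem exists_box_subset {s : Set (∀ i, X i)} (hs : IsOpen s) {x : ∀ i, X i} (hx : x ∈ s) :
    ∃ a : WeakProduct fun i => Opens (X i), x ∈ box a ∧ box a ⊆ s := by
  classical
  obtain ⟨E, u, hu, hsub⟩ := isOpen_pi_iff.1 hs x hx
  refine ⟨⟨fun i => if h : i ∈ E then ⟨u i, (hu i h).1⟩ else ⊤,
    E.finite_toSet.subset fun i hi => ?_⟩, fun i => ?_, fun y hy => hsub fun i hi => ?_⟩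
  · by_contra h
    exact hi (dif_neg h)
  · by_cases h : i ∈ E
    · simpa [h] using (hu i h).2
    · simp [h]
  · have h := hy i
    simp only [Finset.mem_coe] at hi
    simpa [hi] using h

/-- Soundness of the presentation, by induction on the derivation: in a splitting, the `i`-th
coordinate of a point lies in some member of `S`, and the other rules visibly preserve pointwise
covering. This is what makes `boxPoint` preserve joins. -/
theorem subset_biUnion_box_of_cov {a : WeakProduct fun i => Opens (X i)}
    {U : Set (WeakProduct fun i => Opens (X i))}
    (h : (productCov fun i => Opens (X i)).Cov a U) : box a ⊆ ⋃ u ∈ U, box u := by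
  induction h with
  | @gen a U h =>
    obtain ⟨i, S, hS, rfl⟩ := h
    intro x hx
    obtain ⟨o, ho, hxo⟩ := Opens.mem_sSup.1 (hS (hx i))
    refine mem_biUnion (x := a.update i o) ⟨by simpa using ho, fun j hj => a.update_of_ne hj o⟩
      fun j => ?_
    by_cases hj : j = i
    · subst hj; simpa using hxo
    · rw [a.update_of_ne hj]; exact hx j
  | refl h => exact fun x hx => mem_biUnion h hx
  | le h => exact fun x hx => mem_biUnion rfl (box_mono h hx)
  | meet _ _ ihU ihV =>
    intro x hx
    obtain ⟨u, hu, hxu⟩ := mem_iUnion₂.1 (ihU hx)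
    obtain ⟨v, hv, hxv⟩ := mem_iUnion₂.1 (ihV hx)
    exact mem_biUnion (x := u ⊓ v) ⟨⟨u, hu, inf_le_left⟩, v, hv, inf_le_right⟩
      (by rw [box_inf]; exact ⟨hxu, hxv⟩)
  | trans _ _ ihU ihV =>
    intro x hx
    obtain ⟨u, hu, hxu⟩ := mem_iUnion₂.1 (ihU hx)
    exact ihV u hu hxu

/-- A nonempty box determines its sides, so inclusion of boxes is then the coordinatewise order. An
empty box has an empty side, and splitting that side along the empty set covers it by nothing. -/
theorem cov_singleton_of_box_subset {a b : WeakProduct fun i => Opens (X i)}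
    (h : box a ⊆ box b) : (productCov fun i => Opens (X i)).Cov a {b} := by
  classical
  by_cases hne : ∀ i, ∃ x, x ∈ a.1 i
  · choose x hx using hne
    refine CoveringRelation.le _ fun i y hy => ?_
    have hy' : Function.update x i y ∈ box a := fun j => by
      by_cases hj : j = i
      · subst hj; simpa using hy
      · simpa [hj] using hx j
    simpa using h hy' i
  · push Not at hne
    obtain ⟨i, hi⟩ := hne
    exact CoveringRelation.mono _
      (productCov_empty (Opens.ext (eq_empty_of_forall_notMem hi))) (empty_subset _)

/-! ### Points of the localic product -/

/-- The point of the localic product given by a point of the product space. -/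
def boxPoint (x : ∀ i, X i) : FrameHom (LocalicProduct fun i => Opens (X i)) Prop where
  toFun y := ∃ a, x ∈ box a ∧ CoveringRelation.Loc.mk {a} ≤ y
  map_inf' y z := by
    refine propext ⟨?_, ?_⟩
    · rintro ⟨a, ha, h⟩
      exact ⟨⟨a, ha, h.trans inf_le_left⟩, a, ha, h.trans inf_le_right⟩
    · rintro ⟨⟨a, ha, h⟩, b, hb, k⟩
      refine ⟨a ⊓ b, by rw [box_inf]; exact ⟨ha, hb⟩, le_inf (le_trans ?_ h) (le_trans ?_ k)⟩
      · rintro _ rfl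
        exact CoveringRelation.le _ inf_le_left
      · rintro _ rfl
        exact CoveringRelation.le _ inf_le_right
  map_top' := eq_true ⟨⊤, by simp [box_top], le_top⟩
  map_sSup' S := by
    refine propext ⟨?_, ?_⟩
    · rintro ⟨a, ha, h⟩
      rw [CoveringRelation.Loc.sSup_eq] at h
      obtain ⟨u, ⟨U, hU, hu⟩, hxu⟩ := mem_iUnion₂.1 (subset_biUnion_box_of_cov (h a rfl) ha)
      rw [sSup_Prop_eq]
      refine ⟨_, mem_image_of_mem _ hU, u, hxu, ?_⟩
      rintro _ rfl
      exact CoveringRelation.refl _ hu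
    · rw [sSup_Prop_eq]
      rintro ⟨_, ⟨y, hy, rfl⟩, a, ha, h⟩
      exact ⟨a, ha, h.trans (le_sSup hy)⟩

theorem boxPoint_mk (x : ∀ i, X i) (U : Set (WeakProduct fun i => Opens (X i))) :
    boxPoint x (CoveringRelation.Loc.mk U) ↔ x ∈ ⋃ u ∈ U, box u := by
  constructor
  · rintro ⟨a, ha, h⟩
    exact subset_biUnion_box_of_cov (h a rfl) ha
  · intro h
    obtain ⟨u, hu, hxu⟩ := mem_iUnion₂.1 h
    refine ⟨u, hxu, ?_⟩
    rintro _ rfl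
    exact CoveringRelation.refl _ hu

/-! ### Regularity: shrinking open sets and locating the points of the locale -/

theorem exists_isOpen_closure_subset {Y : Type v} [TopologicalSpace Y] [RegularSpace Y]
    {o : Opens Y} {y : Y} (h : y ∈ o) : ∃ p : Opens Y, y ∈ p ∧ closure (p : Set Y) ⊆ o := by
  obtain ⟨t, ht, hc, hto⟩ := exists_mem_nhds_isClosed_subset (o.isOpen.mem_nhds h)
  exact ⟨⟨interior t, isOpen_interior⟩, mem_interior_iff_mem_nhds.2 ht,
    (closure_minimal interior_subset hc).trans hto⟩

/-- The complement of the closure of an open set. -/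
def Opens.exterior {Y : Type v} [TopologicalSpace Y] (o : Opens Y) : Opens Y :=
  ⟨(closure (o : Set Y))ᶜ, isClosed_closure.isOpen_compl⟩

/-- A cover by a family maps to a true join under every point. -/
theorem exists_map_mk_of_cov (p : FrameHom (LocalicProduct fun i => Opens (X i)) Prop)
    {a : WeakProduct fun i => Opens (X i)} {U : Set (WeakProduct fun i => Opens (X i))}
    (h : (productCov fun i => Opens (X i)).Cov a U) (ha : p (CoveringRelation.Loc.mk {a})) :
    ∃ u ∈ U, p (CoveringRelation.Loc.mk {u}) := by
  have h1 : (CoveringRelation.Loc.mk {a} : LocalicProduct fun i => Opens (X i)) ≤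
      sSup ((fun u => CoveringRelation.Loc.mk {u}) '' U) := by
    rintro _ rfl
    exact CoveringRelation.mono _ h fun u hu => ⟨{u}, mem_image_of_mem _ hu, rfl⟩
  have h2 := OrderHomClass.mono p h1 ha
  rw [map_sSup, sSup_Prop_eq] at h2
  obtain ⟨_, ⟨_, ⟨u, hu, rfl⟩, rfl⟩, hpu⟩ := h2
  exact ⟨u, hu, hpu⟩

variable [∀ i, RegularSpace (X i)]

theorem le_sSup_closure_subset {i : ι} (o : Opens (X i)) :
    o ≤ sSup {p : Opens (X i) | closure (p : Set (X i)) ⊆ o} := fun _ hy =>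
  let ⟨p, hyp, hp⟩ := exists_isOpen_closure_subset hy
  Opens.mem_sSup.2 ⟨p, hp, hyp⟩

/-- Every point of the localic product of regular spaces is given by a point of the product
space. -/
theorem exists_point_of_frameHom (p : FrameHom (LocalicProduct fun i => Opens (X i)) Prop) :
    ∃ x : ∀ i, X i, ∀ a, p (CoveringRelation.Loc.mk {a}) ↔ x ∈ box a := by
  have mono : ∀ {a b : WeakProduct fun i => Opens (X i)}, a ≤ b →
      p (CoveringRelation.Loc.mk {a}) → p (CoveringRelation.Loc.mk {b}) := by
    intro a b hab
    refine OrderHomClass.mono p ?_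
    rintro _ rfl
    exact CoveringRelation.le _ hab
  have inf : ∀ {a b : WeakProduct fun i => Opens (X i)}, p (CoveringRelation.Loc.mk {a}) →
      p (CoveringRelation.Loc.mk {b}) → p (CoveringRelation.Loc.mk {a ⊓ b}) := by
    intro a b ha hb
    have h1 : p (CoveringRelation.Loc.mk {a} ⊓ CoveringRelation.Loc.mk {b}) := by
      rw [map_inf]; exact ⟨ha, hb⟩
    refine OrderHomClass.mono p ?_ h1
    rintro c ⟨⟨_, rfl, hca⟩, _, rfl, hcb⟩
    exact CoveringRelation.le _ (le_inf hca hcb)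
  have top : p (CoveringRelation.Loc.mk {⊤}) := by
    have h1 : (⊤ : LocalicProduct fun i => Opens (X i)) ≤ CoveringRelation.Loc.mk {⊤} := by
      obtain ⟨U, hU⟩ := CoveringRelation.Loc.exists_rep (⊤ : LocalicProduct fun i => Opens (X i))
      rw [← hU]
      exact fun _ _ => CoveringRelation.le _ le_top
    exact OrderHomClass.mono p h1 (by rw [map_top]; trivial)
  -- Restricting `p` to boxes constrained only in coordinate `i` gives a point of the locale of
  -- opens of `X i`; it suffices to realize each of these.
  have key : ∀ i, ∃ y : X i, ∀ o : Opens (X i),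
      p (CoveringRelation.Loc.mk {WeakProduct.update ⊤ i o}) ↔ y ∈ o := by
    intro i
    have split : ∀ (o : Opens (X i)) (S : Set (Opens (X i))), o ≤ sSup S →
        p (CoveringRelation.Loc.mk {WeakProduct.update ⊤ i o}) →
        ∃ s ∈ S, p (CoveringRelation.Loc.mk {WeakProduct.update ⊤ i s}) := by
      intro o S hS ho
      obtain ⟨u, ⟨hu, -⟩, hpu⟩ := exists_map_mk_of_cov p
        (productCov_split (WeakProduct.update ⊤ i o) i (S := S) (by simpa using hS)) ho
      refine ⟨_, hu, mono (fun j => ?_) hpu⟩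
      by_cases hj : j = i
      · subst hj; simp
      · rw [WeakProduct.update_of_ne _ hj]; exact le_top
    have bot : ∀ a : WeakProduct fun i => Opens (X i), a.1 i = ⊥ →
        ¬ p (CoveringRelation.Loc.mk {a}) := fun a h k => by
      obtain ⟨_, h, -⟩ := exists_map_mk_of_cov p (productCov_empty h) k
      exact h
    -- If the opens rejected by `p` covered the factor, splitting the top box along them would make
    -- `p` accept one of them. Any `y` outside their union will serve; no uniqueness is needed.
    have hN : ∃ y, y ∉ sSup {o : Opens (X i) |
        ¬ p (CoveringRelation.Loc.mk {WeakProduct.update ⊤ i o})} := by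
      by_contra! h
      obtain ⟨s, hs, hps⟩ := split ⊤ _ (fun y _ => h y) (mono (fun j => by
        by_cases hj : j = i
        · subst hj; simp
        · rw [WeakProduct.update_of_ne _ hj]) top)
      exact hs hps
    obtain ⟨y, hy⟩ := hN
    have hy' : ∀ o : Opens (X i), y ∈ o →
        p (CoveringRelation.Loc.mk {WeakProduct.update ⊤ i o}) := fun o ho => by
      by_contra h
      exact hy (Opens.mem_sSup.2 ⟨o, h, ho⟩)
    refine ⟨y, fun o => ⟨fun ho => ?_, hy' o⟩⟩
    -- An accepted `o` contains the closure of an accepted `q`. Were `y` outside `o`, the exterior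
    -- of `q` would be a neighbourhood of `y`, hence accepted too, although it is disjoint from `q`.
    obtain ⟨q, hq, hpq⟩ := split o _ (le_sSup_closure_subset o) ho
    by_contra hyo
    refine bot _ ?_ (inf hpq (hy' (Opens.exterior q) fun h => hyo (hq h)))
    rw [WeakProduct.inf_apply, WeakProduct.update_self, WeakProduct.update_self]
    exact Opens.ext (eq_empty_of_forall_notMem fun z hz => hz.2 (subset_closure hz.1))
  choose x hx using key
  refine ⟨x, fun a => ⟨fun ha i => (hx i _).1 (mono (fun j => ?_) ha), fun ha => ?_⟩⟩
  · by_cases hj : j = i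
    · subst hj; simp
    · rw [WeakProduct.update_of_ne _ hj]; exact le_top
  -- A box is a finite meet of boxes constrained in one coordinate, and `p` preserves finite meets.
  · have h : ∀ E : Finset ι, ∃ b : WeakProduct fun i => Opens (X i),
        (∀ i ∈ E, b.1 i ≤ a.1 i) ∧ p (CoveringRelation.Loc.mk {b}) := by
      classical
      intro E
      induction E using Finset.induction_on with
      | empty => exact ⟨⊤, by simp, top⟩
      | insert i E _ ih =>
        obtain ⟨b, hb, hpb⟩ := ih
        refine ⟨WeakProduct.update ⊤ i (a.1 i) ⊓ b, fun j hj => ?_, inf ((hx i _).2 (ha i)) hpb⟩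
        rcases Finset.mem_insert.1 hj with rfl | hj
        · exact inf_le_left.trans (WeakProduct.update_self _ _ _).le
        · exact inf_le_right.trans (hb j hj)
    obtain ⟨b, hb, hpb⟩ := h a.2.toFinset
    refine mono (fun i => ?_) hpb
    by_cases hi : a.1 i = ⊤
    · rw [hi]; exact le_top
    · exact hb i (by simpa using hi)

/-- The localic product of regular spaces is spatial if and only if its covering relation is the
inclusion of boxes in unions of boxes. -/
theorem isSpatial_localicProduct_iff :
    IsSpatial (LocalicProduct fun i => Opens (X i)) ↔
      ∀ (a : WeakProduct fun i => Opens (X i)) (U : Set (WeakProduct fun i => Opens (X i))),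
        box a ⊆ ⋃ u ∈ U, box u → (productCov fun i => Opens (X i)).Cov a U := by
  constructor
  · intro h a U hU
    by_contra hc
    -- If `a` is not covered by `U`, then `[a] ⊓ [U]` differs from `[a]`; but a separating point
    -- would be a point of `box a` lying in no box of `U`.
    obtain ⟨p, hp⟩ := h (CoveringRelation.Loc.mk {a} ⊓ CoveringRelation.Loc.mk U)
      (CoveringRelation.Loc.mk {a}) fun e => hc (inf_eq_left.1 e a rfl)
    refine hp (le_antisymm (OrderHomClass.mono p inf_le_left) fun ha => ?_)
    rw [map_inf]
    refine ⟨ha, ?_⟩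
    obtain ⟨x, hx⟩ := exists_point_of_frameHom p
    obtain ⟨u, hu, hxu⟩ := mem_iUnion₂.1 (hU ((hx a).1 ha))
    refine OrderHomClass.mono p ?_ ((hx u).2 hxu)
    rintro _ rfl
    exact CoveringRelation.refl _ hu
  · intro h y z hyz
    by_contra! hp
    obtain ⟨U, rfl⟩ := CoveringRelation.Loc.exists_rep y
    obtain ⟨V, rfl⟩ := CoveringRelation.Loc.exists_rep z
    -- Elements not separated by any `boxPoint` have the same union of boxes.
    have e : ⋃ u ∈ U, box u = ⋃ v ∈ V, box v := by
      ext x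
      rw [← boxPoint_mk, ← boxPoint_mk, hp]
    refine hyz (le_antisymm (fun u hu => h u V ?_) fun v hv => h v U ?_)
    · rw [← e]; exact subset_biUnion_of_mem (u := box) hu
    · rw [e]; exact subset_biUnion_of_mem (u := box) hv

/-- Every box is covered by the boxes whose closures it contains coordinatewise. -/
theorem cov_closure_subset (a : WeakProduct fun i => Opens (X i)) :
    (productCov fun i => Opens (X i)).Cov a
      {b | ∀ i, closure (b.1 i : Set (X i)) ⊆ a.1 i} := by
  -- Only the finitely many coordinates other than `⊤` need shrinking.
  refine CoveringRelation.mono _ (CoveringRelation.cov_forall_mem _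
    (fun i (b : WeakProduct fun i => Opens (X i)) => closure (b.1 i : Set (X i)) ⊆ a.1 i)
    (fun i b c hbc hc => (closure_mono (WeakProduct.apply_le hbc i)).trans hc) a.2.toFinset fun i _ =>
    CoveringRelation.mono _ (productCov_split a i (le_sSup_closure_subset (a.1 i)))
      fun b hb => hb.1) fun b hb i => ?_
  by_cases hi : a.1 i = ⊤
  · rw [hi]; exact subset_univ _
  · exact hb i (by simpa using hi)

end Boxes

/-! ### Covers of products -/

namespace CoverMonoid

theorem fine_locallyFine (X : Type u) [TopologicalSpace X] : (fine X).LocallyFine := by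
  rintro U ⟨U', hU', cU, rU⟩ V hV
  choose! f hfU hf using rU
  have hV' : ∀ s ∈ U', ∃ W : Set (Set X), (∀ r ∈ W, IsOpen r) ∧ ⋃₀ W = univ ∧
      Refines W (V (f s)) := fun s hs => hV _ (hfU s hs)
  choose! W hWo hWc hWr using hV'
  refine ⟨localize U' W, ?_, eq_univ_of_forall fun x => ?_, ?_⟩
  · rintro _ ⟨s, hs, t, ht, rfl⟩
    exact (hU' s hs).inter (hWo s hs t ht)
  · obtain ⟨s, hs, hxs⟩ := mem_sUnion.1 (cU ▸ mem_univ x)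
    obtain ⟨t, ht, hxt⟩ := mem_sUnion.1 (hWc s hs ▸ mem_univ x)
    exact ⟨s ∩ t, ⟨s, hs, t, ht, rfl⟩, hxs, hxt⟩
  · rintro _ ⟨s, hs, t, ht, rfl⟩
    obtain ⟨r, hr, htr⟩ := hWr s hs t ht
    exact ⟨f s ∩ r, ⟨_, hfU s hs, r, hr, rfl⟩, inter_subset_inter (hf s hs) htr⟩

/-- The sieve `S` belongs to the trace of the monoid of covers `ν` on the set `A`. -/
def CoversOn {Y : Type u} (ν : CoverMonoid Y) (A : Set Y) (S : Set (Set Y)) : Prop :=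
  {t | t ∩ A ∈ S} ∈ ν.covers

/-! ### Calculus of traces of a monoid of covers -/

section CoversOn

variable {Y : Type u} {ν : CoverMonoid Y} {A : Set Y} {S T : Set (Set Y)}

theorem CoversOn.of_mem (h : A ∈ S) : ν.CoversOn A S :=
  ν.upward _ ν.univ_mem _ fun s hs => ⟨univ, by simpa using h, subset_univ s⟩

theorem CoversOn.mono (h : ν.CoversOn A S) (hST : S ⊆ T) : ν.CoversOn A T :=
  ν.upward _ h _ fun s hs => ⟨s, hST hs, le_rfl⟩

/-- Local fineness enters here: the cover used inside a member `t` is the one witnessing the claim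
on `t ∩ A`, and `r ∩ t` has the same trace on `A` as `r` has on `t ∩ A`. -/
theorem CoversOn.trans (hν : ν.LocallyFine) (h : ν.CoversOn A S)
    (k : ∀ s ∈ S, ν.CoversOn s T) : ν.CoversOn A T := by
  refine ν.upward _ (hν _ h (fun t => {r | r ∩ (t ∩ A) ∈ T}) fun t ht => k _ ht) _ ?_
  rintro _ ⟨s, -, t, ht, rfl⟩
  refine ⟨s ∩ t, ?_, le_rfl⟩
  have e : s ∩ t ∩ A = t ∩ (s ∩ A) := by rw [inter_comm s t, inter_assoc]
  rw [mem_ofPred_eq, e]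
  exact ht

/-- Being closed under subsets lets the trace of an intersection belong to both families. -/
theorem CoversOn.inter (hS : ∀ s ∈ S, ∀ t ⊆ s, t ∈ S) (hT : ∀ s ∈ T, ∀ t ⊆ s, t ∈ T)
    (h : ν.CoversOn A S) (k : ν.CoversOn A T) : ν.CoversOn A (S ∩ T) := by
  refine ν.upward _ (ν.meet_mem _ h _ k) _ ?_
  rintro _ ⟨s, hs, t, ht, rfl⟩
  exact ⟨s ∩ t, ⟨hS _ hs _ (inter_subset_inter_left _ inter_subset_left),
    hT _ ht _ (inter_subset_inter_left _ inter_subset_right)⟩, le_rfl⟩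

end CoversOn

/-! ### The product monoid compared with the fine monoid and with splittings -/

variable {ι : Type u} {X : ι → Type v} [∀ i, TopologicalSpace (X i)]

theorem preimage_mem_prod (i : ι) {O : Set (Set (X i))} (hO : ∀ o ∈ O, IsOpen o)
    (hc : ⋃₀ O = univ) :
    {r | ∃ o ∈ O, r = {x : ∀ i, X i | x i ∈ o}} ∈ (prod fun i => fine (X i)).covers := by
  classical
  refine ⟨{i}, Function.update (fun j => {univ}) i O, fun j => ?_, ?_⟩
  · by_cases hj : j = i
    · subst hj
      rw [Function.update_self]
      exact ⟨O, hO, hc, Refines.rfl⟩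
    · rw [Function.update_of_ne hj]
      exact (fine (X j)).univ_mem
  · rintro _ ⟨s, hs, rfl⟩
    exact ⟨_, ⟨s i, by simpa using hs i (by simp), rfl⟩, fun x hx => hx i (by simp)⟩

theorem prod_covers_subset_fine :
    (prod fun i => fine (X i)).covers ⊆ (fine (∀ i, X i)).covers := by
  rintro W ⟨E, U, hU, hW⟩
  choose V hVo hVc hVr using hU
  refine ⟨rectangles E V, ?_, eq_univ_of_forall fun x => ?_, fun r hr => ?_⟩
  · rintro _ ⟨s, hs, rfl⟩
    exact isOpen_set_pi (s := s) E.finite_toSet fun i hi => hVo i _ (hs i hi)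
  · have h : ∀ i, ∃ s ∈ V i, x i ∈ s := fun i => mem_sUnion.1 (hVc i ▸ mem_univ (x i))
    choose s hs hx using h
    exact ⟨_, ⟨s, fun i _ => hs i, rfl⟩, fun i _ => hx i⟩
  · obtain ⟨s, hs, rfl⟩ := hr
    have h : ∀ i, ∃ t, i ∈ E → t ∈ U i ∧ s i ⊆ t := fun i => by
      by_cases hi : i ∈ E
      · obtain ⟨t, ht, hst⟩ := hVr i _ (hs i hi)
        exact ⟨t, fun _ => ⟨ht, hst⟩⟩
      · exact ⟨∅, fun h => absurd h hi⟩
    choose t ht using h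
    obtain ⟨w, hw, hsub⟩ := hW _ ⟨t, fun i hi => (ht i hi).1, rfl⟩
    exact ⟨w, hw, fun x hx => hsub fun i hi => (ht i hi).2 (hx i hi)⟩

theorem lam_prod_covers_subset_fine :
    (prod fun i => fine (X i)).lam.covers ⊆ (fine (∀ i, X i)).covers :=
  (lam_isLeast _).2 ⟨_, fine_locallyFine _, prod_covers_subset_fine, rfl⟩

/-- A rectangular cover constrains finitely many coordinates. Each constraint is met by one
splitting, along all opens contained in some member of `U i`, and the resulting covers are met
together. -/
theorem cov_of_mem_prod {W : Set (Set (∀ i, X i))}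
    (h : W ∈ (prod fun i => fine (X i)).covers) (a : WeakProduct fun i => Opens (X i)) :
    (productCov fun i => Opens (X i)).Cov a {b | ∃ w ∈ W, box b ⊆ w} := by
  obtain ⟨E, U, hU, hW⟩ := h
  choose V hVo hVc hVr using hU
  refine CoveringRelation.mono _ (CoveringRelation.cov_forall_mem _
    (fun i (b : WeakProduct fun i => Opens (X i)) => ∃ s ∈ U i, (b.1 i : Set (X i)) ⊆ s)
    (fun i b c hbc ⟨s, hs, hc⟩ => ⟨s, hs, subset_trans (WeakProduct.apply_le hbc i) hc⟩) E fun i _ =>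
    CoveringRelation.mono _ (productCov_split a i
      (S := {o | ∃ s ∈ U i, (o : Set (X i)) ⊆ s}) fun y hy => ?_) fun b hb => hb.1)
      fun b hb => ?_
  · obtain ⟨v, hv, hyv⟩ := mem_sUnion.1 (hVc i ▸ mem_univ y)
    exact Opens.mem_sSup.2 ⟨⟨v, hVo i v hv⟩, hVr i v hv, hyv⟩
  · have h : ∀ i, ∃ s, i ∈ E → s ∈ U i ∧ (b.1 i : Set (X i)) ⊆ s := fun i => by
      by_cases hi : i ∈ E
      · obtain ⟨s, hs⟩ := hb i hi
        exact ⟨s, fun _ => hs⟩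
      · exact ⟨∅, fun h => absurd h hi⟩
    choose s hs using h
    obtain ⟨w, hw, hsub⟩ := hW _ ⟨s, fun i hi => (hs i hi).1, rfl⟩
    exact ⟨w, hw, fun x hx => hsub fun i hi => (hs i hi).2 (hx i)⟩

/-- The covers in the locally fine coreflection of the product monoid yield covers in the localic
product. -/
theorem LamCover.cov {W : Set (Set (∀ i, X i))}
    (h : LamCover (prod fun i => fine (X i)) W) :
    ∀ a, (productCov fun i => Opens (X i)).Cov a {b | ∃ w ∈ W, box b ⊆ w} := by
  induction h with
  | base h => exact cov_of_mem_prod h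
  | @step U W V hU _ hW ih =>
    intro a
    refine CoveringRelation.trans _ (cov_of_mem_prod hU a) ?_
    rintro b ⟨u, hu, hbu⟩
    -- Keeping the new boxes below `b` keeps them inside `u`, as the localized cover requires.
    refine CoveringRelation.mono _ (CoveringRelation.cov_inter_Iic _ ?_ (ih u hu b)) ?_
    · rintro c d hcd ⟨v, hv, hdv⟩
      exact ⟨v, hv, (box_mono hcd).trans hdv⟩
    · rintro c ⟨hcb, v, hv, hcv⟩
      obtain ⟨w, hw, hsub⟩ := hW _ ⟨u, hu, v, hv, rfl⟩
      exact ⟨w, hw, (subset_inter ((box_mono hcb).trans hbu) hcv).trans hsub⟩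

/-- Boxes whose closures lie coordinatewise in `a` are covered, in every locally fine monoid
containing the product monoid, by the boxes lying in the same way in the elements of a cover
of `a`. -/
theorem coversOn_of_cov [∀ i, RegularSpace (X i)] {ν : CoverMonoid (∀ i, X i)}
    (hν : ν.LocallyFine) (hprod : (prod fun i => fine (X i)).covers ⊆ ν.covers)
    {a : WeakProduct fun i => Opens (X i)} {U : Set (WeakProduct fun i => Opens (X i))}
    (h : (productCov fun i => Opens (X i)).Cov a U) :
    ∀ b : WeakProduct fun i => Opens (X i), (∀ i, closure (b.1 i : Set (X i)) ⊆ a.1 i) →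
      ν.CoversOn (box b) {s | s = ∅ ∨ ∃ u ∈ U, ∃ c : WeakProduct fun i => Opens (X i),
        (∀ i, closure (c.1 i : Set (X i)) ⊆ u.1 i) ∧ s ⊆ box c} := by
  have down : ∀ U : Set (WeakProduct fun i => Opens (X i)),
      ∀ s ∈ {s | s = ∅ ∨ ∃ u ∈ U, ∃ c : WeakProduct fun i => Opens (X i),
        (∀ i, closure (c.1 i : Set (X i)) ⊆ u.1 i) ∧ s ⊆ box c},
      ∀ t ⊆ s, t ∈ {s | s = ∅ ∨ ∃ u ∈ U, ∃ c : WeakProduct fun i => Opens (X i),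
        (∀ i, closure (c.1 i : Set (X i)) ⊆ u.1 i) ∧ s ⊆ box c} := by
    rintro U s (rfl | ⟨u, hu, c, hc, hs⟩) t ht
    · exact Or.inl (subset_empty_iff.1 ht)
    · exact Or.inr ⟨u, hu, c, hc, ht.trans hs⟩
  induction h with
  | @gen a U h =>
    obtain ⟨i, S, hS, rfl⟩ := h
    intro b hb
    -- The members of `S` are replaced by opens `p` with closure inside them, so that the new boxes
    -- are again shrunken. The complement of the closure of `b i` completes the cover of `X i`; its
    -- trace on `box b` is empty, which is why the family admits `∅`.
    refine ν.upward _ (hprod (preimage_mem_prod i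
      (O := {o | o = (closure (b.1 i : Set (X i)))ᶜ ∨
        ∃ s ∈ S, ∃ p : Opens (X i), closure (p : Set (X i)) ⊆ s ∧ o = p}) ?_ ?_)) _ ?_
    · rintro o (rfl | ⟨s, hs, p, hp, rfl⟩)
      · exact isClosed_closure.isOpen_compl
      · exact p.isOpen
    · refine eq_univ_of_forall fun y => ?_
      by_cases hy : y ∈ closure (b.1 i : Set (X i))
      · obtain ⟨s, hs, hys⟩ := Opens.mem_sSup.1 (hS (hb i hy))
        obtain ⟨p, hyp, hp⟩ := exists_isOpen_closure_subset hys
        exact ⟨p, Or.inr ⟨s, hs, p, hp, rfl⟩, hyp⟩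
      · exact ⟨_, Or.inl rfl, hy⟩
    · rintro _ ⟨o, ho, rfl⟩
      refine ⟨_, ?_, le_rfl⟩
      rcases ho with rfl | ⟨s, hs, p, hp, rfl⟩
      · left
        exact eq_empty_of_forall_notMem fun x hx => hx.1 (subset_closure (hx.2 i))
      · right
        refine ⟨a.update i s, ⟨by simpa using hs, fun j hj => a.update_of_ne hj s⟩,
          b.update i p, fun j => ?_, fun x hx j => ?_⟩ <;> by_cases hj : j = i
        · subst hj; simpa using hp
        · rw [a.update_of_ne hj, b.update_of_ne hj]; exact hb j
        · subst hj; simpa using hx.1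
        · rw [b.update_of_ne hj]; exact hx.2 j
  | @refl a U h => exact fun b hb => .of_mem (Or.inr ⟨a, h, b, hb, le_rfl⟩)
  | @le a c h =>
    exact fun b hb => .of_mem (Or.inr ⟨c, rfl, b, fun i => (hb i).trans (h i), le_rfl⟩)
  | @meet a U V _ _ ihU ihV =>
    intro b hb
    refine ((ihU b hb).inter (down U) (down V) (ihV b hb)).mono ?_
    rintro s ⟨hs | ⟨u, hu, c, hc, hsc⟩, hs | ⟨v, hv, d, hd, hsd⟩⟩
    · exact Or.inl hs
    · exact Or.inl hs
    · exact Or.inl hs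
    · refine Or.inr ⟨u ⊓ v, ⟨⟨u, hu, inf_le_left⟩, v, hv, inf_le_right⟩, c ⊓ d, fun i => ?_, ?_⟩
      · exact subset_inter ((closure_mono inter_subset_left).trans (hc i))
          ((closure_mono inter_subset_right).trans (hd i))
      · rw [box_inf]; exact subset_inter hsc hsd
  | @trans a U V _ _ ihU ihV =>
    intro b hb
    refine (ihU b hb).trans hν ?_
    rintro s (rfl | ⟨u, hu, c, hc, hs⟩)
    · exact .of_mem (Or.inl rfl)
    -- The intermediate piece `s` lies in a box `c` shrunken inside `u`, so the induction hypothesis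
    -- for `u` applies to `c` and restricts to `s`.
    · refine ν.upward _ (ihV u hu c hc) _ fun t ht => ⟨t, ?_, le_rfl⟩
      exact down V _ ht _ (inter_subset_inter_right _ hs)

/-- An empty product has an empty factor, and the empty family is an open cover of that factor. -/
theorem empty_mem_prod [h : IsEmpty (∀ i, X i)] : ∅ ∈ (prod fun i => fine (X i)).covers := by
  obtain ⟨i, hi⟩ := isEmpty_pi.1 h
  refine (prod fun i => fine (X i)).upward _ (preimage_mem_prod i (O := ∅) (by simp) ?_) _ ?_
  · exact Subsingleton.elim _ _
  · rintro _ ⟨o, ho, -⟩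
    exact absurd ho (notMem_empty o)

end CoverMonoid

/-! ### The equivalence -/

theorem theorem8p6 {ι : Type u} (X : ι → Type v) [∀ i, TopologicalSpace (X i)]
    [∀ i, RegularSpace (X i)] :
    IsSpatial (LocalicProduct fun i => TopologicalSpace.Opens (X i)) ↔
      (CoverMonoid.prod fun i => CoverMonoid.fine (X i)).lam = CoverMonoid.fine (∀ i, X i) := by
  rw [isSpatial_localicProduct_iff]
  constructor
  · intro h
    refine CoverMonoid.ext (Subset.antisymm CoverMonoid.lam_prod_covers_subset_fine ?_)
    rintro W ⟨V, hVo, hVc, hVW⟩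
    -- Traces equal to `∅` must be placed in some member of `V`, which exists once the product has a
    -- point.
    cases isEmpty_or_nonempty (∀ i, X i) with
    | inl he =>
      exact CoverMonoid.upward _ _ (CoverMonoid.LamCover.base CoverMonoid.empty_mem_prod) _
        fun s hs => absurd hs (notMem_empty s)
    | inr hne =>
      obtain ⟨x⟩ := hne
      obtain ⟨v, hv, -⟩ := mem_sUnion.1 (hVc ▸ mem_univ x)
      have hcov := h ⊤ {u | ∃ v ∈ V, box u ⊆ v} fun y _ => by
        obtain ⟨w, hw, hyw⟩ := mem_sUnion.1 (hVc ▸ mem_univ y)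
        obtain ⟨u, hyu, hu⟩ := exists_box_subset (hVo w hw) hyw
        exact mem_biUnion (x := u) ⟨w, hw, hu⟩ hyu
      refine CoverMonoid.upward _ _ (CoverMonoid.coversOn_of_cov
        (CoverMonoid.lam_locallyFine _) (fun _ hU => .base hU) hcov ⊤
        fun i => subset_univ _) _ (Refines.trans ?_ hVW)
      rintro s (hs | ⟨u, ⟨w, hw, huw⟩, c, hc, hs⟩)
      · rw [box_top, inter_univ] at hs
        exact ⟨v, hv, hs ▸ empty_subset v⟩
      · rw [box_top, inter_univ] at hs
        exact ⟨w, hw, (hs.trans (box_mono fun i => subset_closure.trans (hc i))).trans huw⟩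
  · intro h a U hU
    refine CoveringRelation.trans _ (cov_closure_subset a) fun b hb => ?_
    -- A point of `box a` lies in a box of `U`. Any other point has some coordinate outside `a i`,
    -- hence outside the closure of `b i`. So this is an open cover of the whole product.
    have hW : {s | (∃ u ∈ U, s = box u) ∨ ∃ i, s = {x : ∀ i, X i |
        x i ∉ closure (b.1 i : Set (X i))}} ∈ (CoverMonoid.fine (∀ i, X i)).covers := by
      refine ⟨_, ?_, eq_univ_of_forall fun x => ?_, Refines.rfl⟩
      · rintro s (⟨u, -, rfl⟩ | ⟨i, rfl⟩)
        · exact isOpen_box u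
        · exact isClosed_closure.isOpen_compl.preimage (continuous_apply i)
      · by_cases hx : x ∈ box a
        · obtain ⟨u, hu, hxu⟩ := mem_iUnion₂.1 (hU hx)
          exact ⟨_, Or.inl ⟨u, hu, rfl⟩, hxu⟩
        · obtain ⟨i, hi⟩ := not_forall.1 hx
          exact ⟨_, Or.inr ⟨i, rfl⟩, fun k => hi (hb i k)⟩
    rw [← h] at hW
    refine CoveringRelation.trans _ (CoveringRelation.cov_inter_Iic _ ?_
      (CoverMonoid.LamCover.cov hW b)) ?_
    · rintro c d hcd ⟨w, hw, hdw⟩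
      exact ⟨w, hw, (box_mono hcd).trans hdw⟩
    · rintro c ⟨hcb, _, ⟨u, hu, rfl⟩ | ⟨i, rfl⟩, hcw⟩
      · exact CoveringRelation.mono _ (cov_singleton_of_box_subset hcw)
          (singleton_subset_iff.2 hu)
      -- Here `box c` lies in `box b` and also misses the closure of `b i` in coordinate `i`, so it
      -- is empty and is contained in a box with an empty side.
      · refine CoveringRelation.trans _ (cov_singleton_of_box_subset
          (b := WeakProduct.update ⊤ i ⊥) fun x hx => ?_) ?_
        · exact absurd (subset_closure (box_mono hcb hx i)) (hcw hx)
        · rintro _ rfl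
          exact CoveringRelation.mono _ (productCov_empty (WeakProduct.update_self _ _ _))
            (empty_subset _)
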